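/- Let \(\mathcal V\) be a variety of algebras, i.e. the category of models in \(\mathrm{Set}\) (finite-product-preserving functors \(T\to\mathrm{Set}\)) of a Lawvere theory \(T\), a small category with finite products in which every object is isomorphic to a finite power of a distinguished object. Let \(\mathcal{V}^c\) be the category of co-\(\mathcal V\)-algebras in \(\mathcal V\), i.e. the opposite of the category of models of \(T\) in \(\mathcal V^{\mathrm{op}}\). Each \(B\in\mathcal V^c\) represents a functor \(\mathrm{Hom}_{\mathcal V}(B,-)\colon\mathcal V\to\mathcal V\). Give \(\mathcal V^c\) the Tall–Wraith monoidal structure \((\odot, I)\), the one corresponding to composition of representable functors, so that \(\mathrm{Hom}_{\mathcal V}(B_1\odot B_2,A)\cong\mathrm{Hom}_{\mathcal V}(B_1,\mathrm{Hom}_{\mathcal V}(B_2,A))\) and \(\mathrm{Hom}_{\mathcal V}(I,A)\cong A\). A Tall–Wraith \(\mathcal V\)-monoid is a monoid object in \((\mathcal V^c,\odot,I)\). Let \(\hat F\colon\mathrm{Set}\to\mathcal V^c\) be the lift of the free algebra functor \(F\colon\mathrm{Set}\to\mathcal V\) for which the bijections \(\mathrm{Hom}_{\mathcal V}(\hat F(S),A)\cong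 A^S\) are isomorphisms of algebras, \(A^S\) having the pointwise operations. Then, for every monoid \(M\), the object \(\hat F(M)\), whose underlying algebra is the free algebra \(F(M)\), carries the structure of a Tall–Wraith \(\mathcal V\)-monoid induced by the structure of \(M\): under \(\mathrm{Hom}_{\mathcal V}(\hat F(M),A)\cong A^M\) its multiplication corresponds to the maps \(A^M\to(A^M)^M\), \(a\mapsto(m\mapsto(n\mapsto a(mn)))\), and its unit to \(A^M\to A\), \(a\mapsto a(1)\), for all \(A\in\mathcal V\). With these structures, \(\hat F\) lifts to a functor \(\tilde F\) from monoids to Tall–Wraith \(\mathcal V\)-monoids; that is, the underlying co-\(\mathcal V\)-algebra of \(\tilde F(M)\) is \(\hat F(M)\), and \(\tilde F(f)\) has underlying morphism \(\hat F(f)\) for every monoid homomorphism \(f\). -/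

import Mathlib

open CategoryTheory

universe v' u' u

namespace TallWraith

open Limits Opposite MonoidalCategory

/-- A Lawvere theory: a (small) category with finite cartesian products and a distinguished object
`gen` such that every object is isomorphic to a finite cartesian power of `gen`. -/
class LawvereTheory (T : Type u) [SmallCategory T] : Type u extends HasFiniteProducts T where
  gen : T
  exists_iso_pow (t : T) : ∃ n : ℕ, Nonempty (t ≅ ∏ᶜ fun _ : Fin n => gen)

/-- A functor `T ⥤ D` is a model of `T` in `D` if it preserves finite products. -/
abbrev isModel (T : Type u) [SmallCategory T] (D : Type u') [Category.{v'} D] :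
    ObjectProperty (T ⥤ D) :=
  fun F => PreservesFiniteProducts F

/-- The category of models of `T` in `D`: product preserving functors and natural transformations. -/
abbrev Model (T : Type u) [SmallCategory T] (D : Type u') [Category.{v'} D] :=
  (isModel T D).FullSubcategory

/-- The variety of algebras of `T`: models in sets. The underlying set of `A` is
`A.obj.obj LawvereTheory.gen`; an operation is `A.obj.map f` for a morphism `f` of `T`. -/
abbrev Alg (T : Type u) [SmallCategory T] := Model T (Type u)

section Reflection

variable (T : Type u) [SmallCategory T] [HasFiniteProducts T]

/-- The canonical map from the coproduct of the functors represented by a finite family of objects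
to the functor represented by their product; `P` preserves the product iff it is local for it. -/
noncomputable def prodMap (i : Σ n : ℕ, Fin n → T) :
    (∐ fun k => coyoneda.obj (op (i.2 k))) ⟶ coyoneda.obj (op (∏ᶜ i.2)) :=
  Sigma.desc fun k => coyoneda.map (Pi.π i.2 k).op

lemma bijective_iff (i : Σ n : ℕ, Fin n → T) (P : T ⥤ Type u) :
    Function.Bijective (fun g : coyoneda.obj (op (∏ᶜ i.2)) ⟶ P => prodMap T i ≫ g) ↔
      PreservesLimit (Discrete.functor i.2) P := by
  have h1 : PreservesLimit (Discrete.functor i.2) P ↔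
      Function.Bijective (fun (x : P.obj (∏ᶜ i.2)) (k : Fin i.1) => P.map (Pi.π i.2 k) x) := by
    have h2 : PreservesLimit (Discrete.functor i.2) P ↔
        Nonempty (IsLimit (P.mapCone (limit.cone (Discrete.functor i.2)))) :=
      ⟨fun h => ⟨isLimitOfPreserves P (limit.isLimit _)⟩,
        fun ⟨h⟩ => preservesLimit_of_preserves_limit_cone (limit.isLimit _) h⟩
    rw [h2, Types.isLimit_iff, Function.bijective_iff_existsUnique]
    constructor
    · intro h b
      obtain ⟨x, hx, hx'⟩ := h (fun k => b k.as) (by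
        rintro ⟨j⟩ ⟨k⟩ ⟨⟨h⟩⟩
        dsimp at h
        subst h
        exact types_congr_hom (P.map_id _) (b j))
      exact ⟨x, funext fun k => hx ⟨k⟩, fun y hy => hx' y fun k => congrFun hy k.as⟩
    · intro h s _
      obtain ⟨x, hx, hx'⟩ := h (fun k => s ⟨k⟩)
      exact ⟨x, fun k => congrFun hx k.as, fun y hy => hx' y (funext fun k => hy ⟨k⟩)⟩
  have h3 (g : coyoneda.obj (op (∏ᶜ i.2)) ⟶ P) (k : Fin i.1) :
      coyonedaEquiv (Sigma.ι (fun k => coyoneda.obj (op (i.2 k))) k ≫ prodMap T i ≫ g) =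
        P.map (Pi.π i.2 k) (coyonedaEquiv g) := by
    simp [prodMap, coyonedaEquiv, ← NatTrans.naturality_apply]
  rw [h1, Function.bijective_iff_existsUnique, Function.bijective_iff_existsUnique]
  constructor
  · intro h b
    obtain ⟨g, hg, hg'⟩ := h (Sigma.desc fun k => coyonedaEquiv.symm (b k))
    refine ⟨coyonedaEquiv g, ?_, fun y hy => ?_⟩
    · funext k
      dsimp only at hg ⊢
      rw [← h3, hg, colimit.ι_desc]
      simp
    · rw [← hg' (coyonedaEquiv.symm y) ?_, Equiv.apply_symm_apply]
      refine Sigma.hom_ext _ _ fun k => ?_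
      apply coyonedaEquiv.injective
      rw [h3, colimit.ι_desc]
      simpa using congrFun hy k
  · intro h b
    obtain ⟨x, hx, hx'⟩ := h fun k => coyonedaEquiv (Sigma.ι (fun k => coyoneda.obj (op (i.2 k))) k ≫ b)
    refine ⟨coyonedaEquiv.symm x, ?_, fun y hy => ?_⟩
    · refine Sigma.hom_ext _ _ fun k => ?_
      apply coyonedaEquiv.injective
      rw [h3, Equiv.apply_symm_apply]
      exact congrFun hx k
    · rw [Equiv.eq_symm_apply]
      refine hx' _ (funext fun k => ?_)
      dsimp only at hy ⊢
      rw [← hy, h3]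

lemma isLocal_eq :
    isModel T (Type u) = (MorphismProperty.ofHoms (prodMap T)).isLocal := by
  ext P
  constructor
  · rintro h _ _ _ ⟨i⟩
    exact (bijective_iff T i P).2 inferInstance
  · intro h
    refine ⟨fun n => ?_⟩
    apply +allowSynthFailures preservesLimitsOfShape_of_discrete
    intro f
    exact (bijective_iff T ⟨n, f⟩ P).1 (h _ ⟨_⟩)

attribute [local instance] Cardinal.fact_isRegular_aleph0

instance (t : T) : IsCardinalPresentable (coyoneda.obj (op t)) Cardinal.aleph0.{u} where
  preservesColimitOfShape J _ _ := by
    let e : (coyoneda.obj (op (coyoneda.obj (op t)))) ≅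
        (evaluation _ _).obj t :=
      NatIso.ofComponents (fun P ↦ Equiv.toIso coyonedaEquiv)
    exact preservesColimitsOfShape_of_natIso e.symm

/-- Algebras are reflective in all functors `T ⥤ Type u`. -/
instance : (isModel T (Type u)).ι.IsRightAdjoint := by
  rw [isLocal_eq T]
  apply MorphismProperty.isRightAdjoint_ι_isLocal _ Cardinal.aleph0.{u}
  rintro _ _ _ ⟨i⟩
  refine ⟨?_, inferInstance⟩
  have : ∀ k : Discrete (Fin i.1), IsCardinalPresentable ((Discrete.functor fun k => coyoneda.obj (op (i.2 k))).obj k) Cardinal.aleph0.{u} := fun k => by dsimp; infer_instance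
  apply isCardinalPresentable_of_isColimit' _ (colimit.isColimit _)
  rw [hasCardinalLT_aleph0_iff]
  infer_instance

noncomputable instance : Reflective (isModel T (Type u)).ι where
  L := _
  adj := Adjunction.ofIsRightAdjoint _

instance : HasColimits (Alg T) := hasColimits_of_reflective (isModel T (Type u)).ι

end Reflection

section Cov

variable (T : Type u) [SmallCategory T] {D : Type u'} [Category.{u} D]

/-- A co-`T`-algebra in `D` is a model of `T` in `Dᵒᵖ`, that is, an object `B` of `Model T Dᵒᵖ`. It
represents the functor `Hom_D(B, -)` from `D` to algebras: `Hom_D(B, A)` is the algebra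
`t ↦ Hom_D(B t, A)`, whose operations come from the co-operations of `B`. -/
def covObj (B : Model T Dᵒᵖ) : D ⥤ Alg T where
  obj A := ⟨B.obj ⋙ yoneda.obj A, by
    have := B.property
    exact comp_preservesFiniteProducts B.obj (yoneda.obj A)⟩
  map g := ObjectProperty.homMk (Functor.whiskerLeft B.obj (yoneda.map g))

variable (D) in
/-- The functor `B ↦ Hom_D(B, -)`. Since a morphism `B ⟶ B'` in `Model T Dᵒᵖ` is a morphism
`B' ⟶ B` of co-algebras, it is covariant on `Model T Dᵒᵖ`. -/
def cov : Model T Dᵒᵖ ⥤ (D ⥤ Alg T) where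
  obj B := covObj T B
  map f :=
    { app A := ObjectProperty.homMk (Functor.whiskerRight f.hom (yoneda.obj A))
      naturality A A' g := by
        ext t x
        exact (Category.assoc _ _ _).symm }
  map_id B := by
    ext A t x
    simp [covObj]
  map_comp f g := by
    ext A t x
    simp [covObj]

lemma cov_map_app {B B' : Model T Dᵒᵖ} (f : B ⟶ B') (A : D) (t : T)
    (x : (B.obj.obj t).unop ⟶ A) :
    (((cov T D).map f).app A).hom.app t x = (f.hom.app t).unop ≫ x := rfl

lemma app_eq {B B' : Model T Dᵒᵖ} (α : (cov T D).obj B ⟶ (cov T D).obj B') (A : D) (t : T)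
    (x : (B.obj.obj t).unop ⟶ A) :
    (α.app A).hom.app t x = (α.app (B.obj.obj t).unop).hom.app t (𝟙 (B.obj.obj t).unop) ≫ x := by
  have h := types_congr_hom (congrArg (fun φ => φ.hom.app t) (α.naturality x)) (𝟙 _)
  have h' : ((((cov T D).obj B).map x).hom.app t (𝟙 (B.obj.obj t).unop)) = x :=
    Category.id_comp x
  have h'' : (α.app A).hom.app t (((cov T D).obj B).map x |>.hom.app t (𝟙 (B.obj.obj t).unop)) =
    (α.app (B.obj.obj t).unop).hom.app t (𝟙 (B.obj.obj t).unop) ≫ x := h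
  rwa [h'] at h''

/-- The Yoneda argument: `cov` is fully faithful. -/
def covFullyFaithful : (cov T D).FullyFaithful where
  preimage {B B'} α := ObjectProperty.homMk
    { app t := Quiver.Hom.op (X := (B'.obj.obj t).unop) (Y := (B.obj.obj t).unop)
        ((α.app (B.obj.obj t).unop).hom.app t (𝟙 (B.obj.obj t).unop))
      naturality s t f := by
        apply Quiver.Hom.unop_inj
        have h := types_congr_hom ((α.app (B.obj.obj s).unop).hom.naturality f)
          (𝟙 (B.obj.obj s).unop)
        have h' : (α.app (B.obj.obj s).unop).hom.app t ((B.obj.map f).unop ≫ 𝟙 _) =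
          (B'.obj.map f).unop ≫ (α.app (B.obj.obj s).unop).hom.app s (𝟙 _) := h
        rw [Category.comp_id, app_eq] at h'
        exact h' }
  map_preimage {B B'} α := by
    ext A t x
    exact (app_eq T α A t x).symm
  preimage_map {B B'} f := by
    ext t
    apply Quiver.Hom.unop_inj
    exact Category.comp_id _

instance : (cov T D).Full := (covFullyFaithful T).full
instance : (cov T D).Faithful := (covFullyFaithful T).faithful

lemma preservesFiniteProducts_of_yoneda (F : T ⥤ Dᵒᵖ)
    (h : ∀ A : D, PreservesFiniteProducts (F ⋙ yoneda.obj A)) : PreservesFiniteProducts F :=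
  ⟨fun _ => ⟨⟨fun hc => ⟨yonedaJointlyReflectsLimits _ _ fun A =>
    isLimitOfPreserves (F ⋙ yoneda.obj A) hc⟩⟩⟩⟩

/-- The co-algebra `t ↦ T(t, -)`, which represents the identity functor of `Alg T`. -/
def representable : T ⥤ (Alg T)ᵒᵖ where
  obj t := op ⟨coyoneda.obj (op t), ⟨fun _ => inferInstance⟩⟩
  map f := (ObjectProperty.homMk (coyoneda.map f.op)).op

/-- Yoneda's lemma. -/
def representableEquiv (t : T) (A : Alg T) :
    (((representable T).obj t).unop ⟶ A) ≃ A.obj.obj t :=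
  (isModel T (Type u)).fullyFaithfulι.homEquiv.trans coyonedaEquiv

lemma representableEquiv_naturality {s t : T} (f : s ⟶ t) (A : Alg T)
    (x : ((representable T).obj s).unop ⟶ A) :
    representableEquiv T t A (((representable T).map f).unop ≫ x) =
      A.obj.map f (representableEquiv T s A x) := by
  change x.hom.app t (f ≫ 𝟙 t) = A.obj.map f (x.hom.app s (𝟙 s))
  have h : x.hom.app t (𝟙 s ≫ f) = A.obj.map f (x.hom.app s (𝟙 s)) :=
    types_congr_hom (x.hom.naturality f) (𝟙 s)
  rw [← h]
  exact congrArg (x.hom.app t) ((Category.comp_id f).trans (Category.id_comp f).symm)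

/-- A functor `D ⥤ Alg T` with a left adjoint is represented by a co-algebra. -/
lemma mem_essImage_cov {L : Alg T ⥤ D} {G : D ⥤ Alg T} (adj : L ⊣ G) :
    (cov T D).essImage G := by
  let e (A : D) : (representable T ⋙ L.op) ⋙ yoneda.obj A ≅ (G.obj A).obj :=
    NatIso.ofComponents (fun t => Equiv.toIso
      ((adj.homEquiv _ A).trans (representableEquiv T t (G.obj A)))) (by
        intro s t f
        ext x
        change representableEquiv T t _ (adj.homEquiv _ A (L.map ((representable T).map f).unop ≫ x))
          = (G.obj A).obj.map f (representableEquiv T s _ (adj.homEquiv _ A x))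
        rw [adj.homEquiv_naturality_left, representableEquiv_naturality])
  refine ⟨⟨representable T ⋙ L.op, preservesFiniteProducts_of_yoneda T _ fun A => ?_⟩, ⟨?_⟩⟩
  · have := (G.obj A).property
    exact ⟨fun _ => preservesLimitsOfShape_of_natIso (e A).symm⟩
  · refine NatIso.ofComponents (fun A => ObjectProperty.isoMk _ (e A)) ?_
    intro A A' g
    ext t x
    change representableEquiv T t _ (adj.homEquiv _ A' (x ≫ g)) =
      (G.map g).hom.app t (representableEquiv T t _ (adj.homEquiv _ A x))
    exact congrArg (representableEquiv T t _) (adj.homEquiv_naturality_right _ _)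

/-- A functor represented by a co-algebra has a left adjoint. -/
lemma isRightAdjoint_cov_obj [HasFiniteProducts T] [HasColimitsOfSize.{u, u} D]
    (B : Model T Dᵒᵖ) : ((cov T D).obj B).IsRightAdjoint := by
  let R : D ⥤ (T ⥤ Type u) := Presheaf.restrictedULiftYoneda.{u} B.obj.leftOp ⋙
    (Functor.whiskeringLeft _ _ _).obj (opOp T)
  have : (Presheaf.restrictedULiftYoneda.{u} B.obj.leftOp).IsRightAdjoint :=
    ⟨_, ⟨Presheaf.uliftYonedaAdjunction.{u} _ (uliftYoneda.leftKanExtensionUnit _)⟩⟩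
  have : R.IsRightAdjoint := inferInstance
  let e : 𝟭 D ⋙ R ≅ (cov T D).obj B ⋙ (isModel T (Type u)).ι :=
    NatIso.ofComponents (fun A => NatIso.ofComponents fun t => Equiv.toIso Equiv.ulift)
  exact ⟨_, ⟨(Adjunction.ofIsRightAdjoint R).restrictFullyFaithful
    (isModel T (Type u)).fullyFaithfulι (Functor.FullyFaithful.id D)
    (L := (isModel T (Type u)).ι ⋙ R.leftAdjoint) (Iso.refl _) e⟩⟩

end Cov

/-- The monoidal structure on endofunctors in which `F ⊗ G` is the composite `F ∘ G` (apply `G`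
first). -/
abbrev compositionMonoidal (C : Type u') [Category.{v'} C] : MonoidalCategory (C ⥤ C) where
  tensorObj F G := G ⋙ F
  whiskerLeft F _ _ α := Functor.whiskerRight α F
  whiskerRight α F := Functor.whiskerLeft F α
  tensorHom α β := β ◫ α
  tensorUnit := 𝟭 C
  associator F G H := (Functor.associator H G F).symm
  leftUnitor F := Functor.rightUnitor F
  rightUnitor F := Functor.leftUnitor F

section TW

variable (T : Type u) [SmallCategory T] [HasFiniteProducts T]

instance : MonoidalCategory (Alg T ⥤ Alg T) := compositionMonoidal (Alg T)

/-- The endofunctors of `Alg T` that are represented by a co-algebra in `Alg T`. -/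
abbrev covRep : ObjectProperty (Alg T ⥤ Alg T) := (cov T (Alg T)).essImage

/-- Representable functors contain the identity and are closed under composition. -/
instance : (covRep T).IsMonoidal where
  prop_unit := mem_essImage_cov T Adjunction.id
  prop_tensor := by
    rintro F G ⟨B, ⟨e⟩⟩ ⟨B', ⟨e'⟩⟩
    have := isRightAdjoint_cov_obj T B
    have := isRightAdjoint_cov_obj T B'
    have := Functor.isRightAdjoint_of_iso e
    have := Functor.isRightAdjoint_of_iso e'
    exact mem_essImage_cov T (Adjunction.ofIsRightAdjoint (G ⋙ F))

instance : (cov T (Alg T)).toEssImage.IsEquivalence where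

/-- The equivalence between (the opposite of) co-algebras in `Alg T` and representable endofunctors. -/
noncomputable def covEquiv : Model T (Alg T)ᵒᵖ ≌ (covRep T).FullSubcategory :=
  (cov T (Alg T)).toEssImage.asEquivalence

/-- The Tall-Wraith monoidal structure: transported from composition of representable functors, so
that `B₁ ⊗ B₂` represents `Hom(B₁, Hom(B₂, -))`. -/
noncomputable instance : MonoidalCategory (Model T (Alg T)ᵒᵖ) :=
  Monoidal.transport (covEquiv T).symm

noncomputable instance : (cov T (Alg T)).toEssImage.Monoidal :=
  inferInstanceAs (Monoidal.equivalenceTransported (covEquiv T).symm).inverse.Monoidal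

/-- `cov` is strong monoidal: `Hom(B₁ ⊗ B₂, A) ≅ Hom(B₁, Hom(B₂, A))` and `Hom(𝟙, A) ≅ A`. -/
noncomputable instance : (cov T (Alg T)).Monoidal :=
  inferInstanceAs ((cov T (Alg T)).toEssImage ⋙ (covRep T).ι).Monoidal

/-- The category of co-`T`-algebras in the category of `T`-algebras, with its Tall-Wraith monoidal
structure (the opposite of the one on `Model T (Alg T)ᵒᵖ`, with the same `⊗` on objects). Its
monoid objects are the Tall-Wraith monoids. -/
abbrev CoAlg := (Model T (Alg T)ᵒᵖ)ᵒᵖ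

/-- The category of Tall-Wraith monoids. -/
abbrev TWMon := Mon (CoAlg T)

/-- `A ↦ A t`; for `t = LawvereTheory.gen` this is the underlying set functor. -/
abbrev evalAt (t : T) : Alg T ⥤ Type u := (isModel T (Type u)).ι ⋙ (evaluation T (Type u)).obj t

/-- The operation `f`, as a natural transformation. -/
def evalMap {s t : T} (f : s ⟶ t) : evalAt T s ⟶ evalAt T t :=
  Functor.whiskerLeft _ ((evaluation T (Type u)).map f)

/-- The left adjoint of `A ↦ A t`; for `t = LawvereTheory.gen` this is the free algebra functor. -/
noncomputable def freeAt (t : T) : Type u ⥤ Alg T := (evalAt T t).leftAdjoint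

/-- The defining adjunction of `freeAt`. -/
noncomputable def freeAdj (t : T) : freeAt T t ⊣ evalAt T t := Adjunction.ofIsRightAdjoint _

/-- The co-operation corresponding to `f` on free algebras, dual to the operation `f`. -/
noncomputable def freeOperation {s t : T} (f : s ⟶ t) : freeAt T t ⟶ freeAt T s :=
  (conjugateEquiv (freeAdj T s) (freeAdj T t)).symm (evalMap T f)

/-- The co-algebra structure on the free algebra on `S`. As `Hom(freeAt t S, A) ≅ (A t) ^ S`, the
value at `t = gen ^ n` is the `n`-fold coproduct of the free algebra on `S`. -/
noncomputable def freeHatDiagram (S : Type u) : T ⥤ (Alg T)ᵒᵖ where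
  obj t := op ((freeAt T t).obj S)
  map f := ((freeOperation T f).app S).op
  map_id t := by
    have : evalMap T (𝟙 t) = 𝟙 _ := by
      ext A x
      exact types_congr_hom (A.obj.map_id t) x
    rw [freeOperation, this, conjugateEquiv_symm_id]
    rfl
  map_comp f g := by
    have : evalMap T (f ≫ g) = evalMap T f ≫ evalMap T g := by
      ext A x
      exact types_congr_hom (A.obj.map_comp f g) x
    rw [freeOperation, this, ← conjugateEquiv_symm_comp _ (freeAdj T _)]
    rfl

/-- The bijection `Hom(freeAt t S, A) ≅ (S → A t)`. -/
noncomputable def freeEquiv (S : Type u) (t : T) (A : Alg T) :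
    ((freeAt T t).obj S ⟶ A) ≃ (S → A.obj.obj t) :=
  ((freeAdj T t).homEquiv S A).trans TypeCat.homEquiv

/-- Under `freeEquiv` the algebra structure of `Hom(freeHat S, A)` is the pointwise one of `A ^ S`. -/
lemma freeEquiv_operation (S : Type u) {s t : T} (f : s ⟶ t) (A : Alg T)
    (x : (freeAt T s).obj S ⟶ A) :
    freeEquiv T S t A ((freeOperation T f).app S ≫ x) =
      fun m => A.obj.map f (freeEquiv T S s A x m) := by
  have h : (freeAdj T t).homEquiv S A ((freeOperation T f).app S ≫ x) =
      (freeAdj T s).homEquiv S A x ≫ (evalMap T f).app A := by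
    rw [Adjunction.homEquiv_unit, Adjunction.homEquiv_unit, Functor.map_comp, freeOperation,
      ← Category.assoc, ← unit_conjugateEquiv_symm, Category.assoc, Category.assoc,
      NatTrans.naturality]
  funext m
  exact types_congr_hom h m

lemma preservesFiniteProducts_freeHatDiagram (S : Type u) :
    PreservesFiniteProducts (freeHatDiagram T S) := by
  refine preservesFiniteProducts_of_yoneda T _ fun A => ?_
  let e : freeHatDiagram T S ⋙ yoneda.obj A ≅ A.obj ⋙ coyoneda.obj (op S) :=
    NatIso.ofComponents
      (fun t => Equiv.toIso ((freeEquiv T S t A).trans TypeCat.homEquiv.symm)) (by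
        intro s t f
        ext x
        exact congrArg TypeCat.ofHom (freeEquiv_operation T S f A x))
  have := A.property
  have : PreservesFiniteProducts (A.obj ⋙ coyoneda.obj (op S)) := inferInstance
  exact ⟨fun _ => preservesLimitsOfShape_of_natIso e.symm⟩

/-- The lift of the free algebra functor to co-algebras in algebras. -/
noncomputable def freeHat : Type u ⥤ CoAlg T where
  obj S := op ⟨freeHatDiagram T S, preservesFiniteProducts_freeHatDiagram T S⟩
  map {S S'} g := Quiver.Hom.op (ObjectProperty.homMk
    { app t := ((freeAt T t).map g).op
      naturality s t f := by
        apply Quiver.Hom.unop_inj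
        exact ((freeOperation T f).naturality g) })
  map_id S := by
    apply Quiver.Hom.unop_inj
    ext t
    apply Quiver.Hom.unop_inj
    exact (freeAt T t).map_id S
  map_comp f g := by
    apply Quiver.Hom.unop_inj
    ext t
    apply Quiver.Hom.unop_inj
    exact (freeAt T t).map_comp f g

/-- For a Tall-Wraith monoid `X`, the map `Hom(X, A) ⟶ Hom(X ⊗ X, A) ≅ Hom(X, Hom(X, A))`. -/
noncomputable def comult (X : CoAlg T) [MonObj X] (A : Alg T) :
    ((cov T (Alg T)).obj X.unop).obj A ⟶
      ((cov T (Alg T)).obj X.unop).obj (((cov T (Alg T)).obj X.unop).obj A) :=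
  ((cov T (Alg T)).map (MonObj.mul (X := X)).unop ≫
    Functor.OplaxMonoidal.δ (cov T (Alg T)) X.unop X.unop).app A

/-- For a Tall-Wraith monoid `X`, the map `Hom(X, A) ⟶ Hom(𝟙, A) ≅ A`. -/
noncomputable def counit (X : CoAlg T) [MonObj X] (A : Alg T) :
    ((cov T (Alg T)).obj X.unop).obj A ⟶ A :=
  ((cov T (Alg T)).map (MonObj.one (X := X)).unop ≫
    Functor.OplaxMonoidal.η (cov T (Alg T))).app A

/-- A Tall-Wraith monoid structure on `freeHat M` is induced by the monoid structure of `M` if, when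
`Hom(freeHat M, A)` is identified with `A ^ M`, its multiplication is
`A ^ M ⟶ (A ^ M) ^ M`, `a ↦ (m ↦ n ↦ a (m * n))`, and its unit is `A ^ M ⟶ A`, `a ↦ a 1`. -/
def IsInduced (M : Type u) [Monoid M] (X : MonObj ((freeHat T).obj M)) : Prop :=
  ∀ (A : Alg T) (t : T) (a : (freeAt T t).obj M ⟶ A),
    (∀ m n : M,
      freeEquiv T M t A
        (freeEquiv T M t (((cov T (Alg T)).obj ((freeHat T).obj M).unop).obj A)
          ((comult T ((freeHat T).obj M) A).hom.app t a) m) n =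
        freeEquiv T M t A a (m * n)) ∧
    (counit T ((freeHat T).obj M) A).hom.app t a = freeEquiv T M t A a 1

end TW

section Underlying

variable (T : Type u) [SmallCategory T] [LawvereTheory T]

/-- The free algebra functor: the left adjoint of the underlying set functor. -/
noncomputable abbrev free : Type u ⥤ Alg T := freeAt T (LawvereTheory.gen : T)

/-- The underlying algebra of a co-algebra in algebras. -/
def underlying : CoAlg T ⥤ Alg T where
  obj B := (B.unop.obj.obj LawvereTheory.gen).unop
  map f := (f.unop.hom.app LawvereTheory.gen).unop

/-- `freeHat` is a lift of the free algebra functor. -/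
lemma freeHat_comp_underlying : freeHat T ⋙ underlying T = free T := rfl

end Underlying

end TallWraith

/-!
Write `A ^ S` for the algebra `Hom(freeHat S, A)`; the operations are pointwise by
`freeEquiv_operation`. For a monoid `M` the endofunctor `A ↦ A ^ M` of algebras is a comonad, with
comultiplication `A ^ M ⟶ (A ^ M) ^ M`, `a ↦ (m ↦ n ↦ a (m * n))`, and counit `a ↦ a 1`: these maps
only reindex coordinates, so they commute with all operations and are natural in `A`, and the
comonad laws are the monoid laws of `M` (`powerComonObj`). A monoid homomorphism `f : M →* N` gives
a morphism of comonads `A ^ N ⟶ A ^ M`, `b ↦ b ∘ f` (`isComonHom_reindex`).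

A comonad is a comonoid for composition of endofunctors, and `A ↦ A ^ M` is the image of `freeHat M`
under the fully faithful strong monoidal functor `cov`. Comonoid structures and their morphisms
pull back along such a functor (`FullyFaithful.comonObj`, `FullyFaithful.isComonHom_of_map`), so
`freeHat M` is a comonoid in `Model T (Alg T)ᵒᵖ`, which is a monoid in the opposite category
`CoAlg T`, functorially in `M` (`freeTW`). Since the structure on `freeHat M` is the pullback of
the comonad structure, its comultiplication and counit are the maps above
(`isInduced_freeHatMonObj`).
-/

universe v₁ v₂ u₁ u₂

/-! ### Comonoid objects and fully faithful monoidal functors -/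

namespace CategoryTheory.Functor

open MonoidalCategory ComonObj LaxMonoidal Functor.Monoidal

variable {C : Type u₁} [Category.{v₁} C] [MonoidalCategory C]
  {D : Type u₂} [Category.{v₂} D] [MonoidalCategory D] {F : C ⥤ D}

/-- Pull back a comonoid object along a fully faithful lax monoidal functor. -/
abbrev FullyFaithful.comonObj [F.LaxMonoidal] (hF : F.FullyFaithful) (X : C)
    [ComonObj (F.obj X)] : ComonObj X where
  counit := hF.preimage (ε[F.obj X] ≫ LaxMonoidal.ε F)
  comul := hF.preimage (Δ[F.obj X] ≫ LaxMonoidal.μ F X X)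
  counit_comul := hF.map_injective <| by
    simp [← μ_natural_left, left_unitality_inv]
  comul_counit := hF.map_injective <| by
    simp [← μ_natural_right, right_unitality_inv]
  comul_assoc := hF.map_injective <| by
    simp [← μ_natural_left_assoc, ← μ_natural_right]

/-- A morphism is a comonoid morphism for the pulled back structures if its image is one. -/
lemma FullyFaithful.isComonHom_of_map [F.LaxMonoidal] (hF : F.FullyFaithful) {X Y : C}
    [ComonObj (F.obj X)] [ComonObj (F.obj Y)] (f : X ⟶ Y) [IsComonHom (F.map f)] :
    letI := hF.comonObj X
    letI := hF.comonObj Y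
    IsComonHom f :=
  letI := hF.comonObj X
  letI := hF.comonObj Y
  { hom_counit := hF.map_injective <| by
      change F.map (f ≫ hF.preimage _) = F.map (hF.preimage _)
      rw [F.map_comp, hF.map_preimage, hF.map_preimage, IsComonHom.hom_counit_assoc]
    hom_comul := hF.map_injective <| by
      change F.map (f ≫ hF.preimage _) = F.map (hF.preimage _ ≫ _)
      simp only [F.map_comp, hF.map_preimage, IsComonHom.hom_comul_assoc, Category.assoc,
        μ_natural] }

end CategoryTheory.Functor

namespace TallWraith

open Limits Opposite MonoidalCategory

/-! ### Powers of algebras -/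

section FreeHat

variable (T : Type u) [SmallCategory T] [HasFiniteProducts T]

lemma freeEquiv_comp (S : Type u) (t : T) {A A' : Alg T} (x : (freeAt T t).obj S ⟶ A)
    (g : A ⟶ A') (m : S) :
    freeEquiv T S t A' (x ≫ g) m = g.hom.app t (freeEquiv T S t A x m) :=
  types_congr_hom ((freeAdj T t).homEquiv_naturality_right x g) m

lemma freeEquiv_map_comp {S S' : Type u} (f : S ⟶ S') (t : T) {A : Alg T}
    (x : (freeAt T t).obj S' ⟶ A) (m : S) :
    freeEquiv T S t A ((freeAt T t).map f ≫ x) m = freeEquiv T S' t A x (f m) :=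
  types_congr_hom ((freeAdj T t).homEquiv_naturality_left f x) m

/-- The endofunctor `A ↦ A ^ S` of algebras, in the form `A ↦ Hom(freeHat S, A)`. -/
noncomputable abbrev power (S : Type u) : Alg T ⥤ Alg T :=
  (cov T (Alg T)).obj ((freeHat T).obj S).unop

variable {T} in
/-- The element of `A ^ S` at `t` with the given coordinates. -/
noncomputable def powerMk {S : Type u} {A : Alg T} {t : T} (a : S → A.obj.obj t) :
    ((power T S).obj A).obj.obj t :=
  (freeEquiv T S t A).symm a

variable {T} in
/-- The coordinate at `m` of an element of `A ^ S` at `t`. -/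
noncomputable def coord {S : Type u} {A : Alg T} {t : T} (a : ((power T S).obj A).obj.obj t)
    (m : S) : A.obj.obj t :=
  freeEquiv T S t A a m

variable {T} {S S' : Type u} {A A' : Alg T} {s t : T}

@[simp] lemma coord_powerMk (a : S → A.obj.obj t) (m : S) : coord (powerMk a) m = a m :=
  congrFun ((freeEquiv T S t A).apply_symm_apply a) m

lemma coord_ext {a b : ((power T S).obj A).obj.obj t} (h : ∀ m, coord a m = coord b m) : a = b :=
  (freeEquiv T S t A).injective (funext h)

lemma coord_operation (f : s ⟶ t) (a : ((power T S).obj A).obj.obj s) (m : S) :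
    coord (((power T S).obj A).obj.map f a) m = A.obj.map f (coord a m) :=
  congrFun (freeEquiv_operation T S f A a) m

lemma coord_power_map (g : A ⟶ A') (a : ((power T S).obj A).obj.obj t) (m : S) :
    coord (((power T S).map g).hom.app t a) m = g.hom.app t (coord a m) :=
  freeEquiv_comp T S t a g m

/-- The map `A ^ S' ⟶ A ^ S` induced by `f : S ⟶ S'` is `a ↦ a ∘ f`. -/
lemma coord_reindex (f : S ⟶ S') (a : ((power T S').obj A).obj.obj t) (m : S) :
    coord ((((cov T (Alg T)).map ((freeHat T).map f).unop).app A).hom.app t a) m =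
      coord a (f m) :=
  freeEquiv_map_comp T f t a m

/-! ### The comonad of powers by a monoid -/

/-- The element `m ↦ n ↦ a (m * n)` of `(A ^ M) ^ M`. -/
noncomputable def translates {M : Type u} [Monoid M] (a : ((power T M).obj A).obj.obj t) :
    ((power T M).obj ((power T M).obj A)).obj.obj t :=
  powerMk fun m => powerMk fun n => coord a (m * n)

@[simp] lemma coord_coord_translates {M : Type u} [Monoid M]
    (a : ((power T M).obj A).obj.obj t) (m n : M) :
    coord (A := A) (coord (A := (power T M).obj A) (translates a) m) n = coord a (m * n) := by
  rw [translates, coord_powerMk, coord_powerMk]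

lemma coord_coord_ext {a b : ((power T S).obj ((power T S').obj A)).obj.obj t}
    (h : ∀ m n, coord (A := A) (coord (A := (power T S').obj A) a m) n =
      coord (A := A) (coord (A := (power T S').obj A) b m) n) : a = b :=
  coord_ext fun m => coord_ext fun n => h m n

lemma translates_operation {M : Type u} [Monoid M] (f : s ⟶ t)
    (a : ((power T M).obj A).obj.obj s) :
    translates (((power T M).obj A).obj.map f a) =
      ((power T M).obj ((power T M).obj A)).obj.map f (translates a) := by
  refine coord_coord_ext fun m n => ?_
  rw [coord_coord_translates, coord_operation, coord_operation, coord_operation,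
    coord_coord_translates]

lemma translates_map {M : Type u} [Monoid M] (g : A ⟶ A')
    (a : ((power T M).obj A).obj.obj t) :
    translates (((power T M).map g).hom.app t a) =
      ((power T M).map ((power T M).map g)).hom.app t (translates a) := by
  refine coord_coord_ext fun m n => ?_
  rw [coord_coord_translates, coord_power_map, coord_power_map, coord_power_map,
    coord_coord_translates]

variable (T) in
/-- The comultiplication `A ^ M ⟶ (A ^ M) ^ M`, `a ↦ (m ↦ n ↦ a (m * n))`. -/
noncomputable def powerComul (M : Type u) [Monoid M] :
    power T M ⟶ power T M ⊗ power T M where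
  app A := ObjectProperty.homMk
    { app t := TypeCat.ofHom (X := ((power T M).obj A).obj.obj t)
        (Y := ((power T M).obj ((power T M).obj A)).obj.obj t) translates
      naturality s t f := by
        ext a
        exact translates_operation f a }
  naturality A A' g := by
    ext t a
    exact translates_map g a

variable (T) in
/-- The counit `A ^ M ⟶ A`, `a ↦ a 1`. -/
noncomputable def powerCounit (M : Type u) [Monoid M] :
    power T M ⟶ 𝟙_ (Alg T ⥤ Alg T) where
  app A := ObjectProperty.homMk
    { app t := TypeCat.ofHom (X := ((power T M).obj A).obj.obj t) (Y := A.obj.obj t)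
        fun a => coord a 1
      naturality s t f := by
        ext a
        exact coord_operation f a 1 }
  naturality A A' g := by
    ext t a
    exact coord_power_map g a 1

/-- The comonad `A ↦ A ^ M` on algebras. In the composition monoidal structure `F ◁ α` is `F` applied
to the components of `α`, and `α ▷ F` is `α` at the objects `F A`. Hence `counit_comul` evaluates the
outer index at `1` and `comul_counit` the inner one. -/
noncomputable instance powerComonObj (M : Type u) [Monoid M] : ComonObj (power T M) where
  counit := powerCounit T M
  comul := powerComul T M
  counit_comul := by
    ext A t a
    change coord (A := (power T M).obj A) (translates a) 1 = a
    refine coord_ext fun n => ?_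
    rw [coord_coord_translates, one_mul]
  comul_counit := by
    ext A t a
    change ((power T M).map ((powerCounit T M).app A)).hom.app t (translates a) = a
    refine coord_ext fun m => ?_
    rw [coord_power_map]
    change coord (A := A) (coord (A := (power T M).obj A) (translates a) m) 1 = _
    rw [coord_coord_translates, mul_one]
  comul_assoc := by
    ext A t a
    change ((power T M).map ((powerComul T M).app A)).hom.app t (translates a) =
      translates (A := (power T M).obj A) (translates a)
    refine coord_coord_ext fun m n => coord_ext fun k => ?_
    rw [coord_power_map, coord_coord_translates, coord_coord_translates]
    change coord (A := A) (coord (A := (power T M).obj A)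
      (translates (coord (A := (power T M).obj A) (translates a) m)) n) k = _
    rw [coord_coord_translates, coord_coord_translates, mul_assoc]

/-- A monoid homomorphism `f : M → N` induces a morphism `A ^ N ⟶ A ^ M` of comonads. -/
instance isComonHom_reindex {M N : Type u} [Monoid M] [Monoid N] (f : M →* N) :
    IsComonHom ((cov T (Alg T)).map ((freeHat T).map (TypeCat.ofHom f)).unop) where
  hom_counit := by
    ext A t a
    change coord (A := A) ((((cov T (Alg T)).map
      ((freeHat T).map (TypeCat.ofHom f)).unop).app A).hom.app t a) 1 = coord a 1
    rw [coord_reindex]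
    exact congrArg (coord a) f.map_one
  hom_comul := by
    set φ := (cov T (Alg T)).map ((freeHat T).map (TypeCat.ofHom f)).unop with hφ
    ext A t a
    change translates ((φ.app A).hom.app t a) =
      ((power T M).map (φ.app A)).hom.app t
        ((φ.app ((power T N).obj A)).hom.app t (translates a))
    refine coord_coord_ext fun m n => ?_
    rw [coord_coord_translates, coord_power_map, hφ, coord_reindex, coord_reindex, coord_reindex,
      coord_coord_translates]
    exact congrArg (coord a) (f.map_mul m n)

/-! ### Tall–Wraith monoids from monoids -/

variable (T) in
/-- The Tall–Wraith monoid structure on `freeHat M`, pulled back along `cov`. -/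
noncomputable abbrev freeHatMonObj (M : Type u) [Monoid M] : MonObj ((freeHat T).obj M) :=
  letI := (covFullyFaithful T (D := Alg T)).comonObj ((freeHat T).obj M).unop
  (Comon.ComonToMonOpOpObj ⟨((freeHat T).obj M).unop⟩).mon

/-- `cov` sends the multiplication to `powerComul` and the unit to `powerCounit`, up to the structure
isomorphisms of `cov`, which `comult` and `counit` cancel. -/
lemma isInduced_freeHatMonObj (M : Type u) [Monoid M] : IsInduced T M (freeHatMonObj T M) := by
  let := freeHatMonObj T M
  have hmul : (cov T (Alg T)).map (MonObj.mul (X := (freeHat T).obj M)).unop =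
      powerComul T M ≫ Functor.LaxMonoidal.μ (cov T (Alg T)) _ _ :=
    (covFullyFaithful T (D := Alg T)).map_preimage _
  have hone : (cov T (Alg T)).map (MonObj.one (X := (freeHat T).obj M)).unop =
      powerCounit T M ≫ Functor.LaxMonoidal.ε (cov T (Alg T)) :=
    (covFullyFaithful T (D := Alg T)).map_preimage _
  have hcomult (A : Alg T) : comult T ((freeHat T).obj M) A = (powerComul T M).app A := by
    rw [comult, hmul, Category.assoc, Functor.Monoidal.μ_δ, Category.comp_id]
  have hcounit (A : Alg T) : counit T ((freeHat T).obj M) A = (powerCounit T M).app A := by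
    rw [counit, hone, Category.assoc, Functor.Monoidal.ε_η, Category.comp_id]
  intro A t a
  refine ⟨fun m n => ?_, ?_⟩
  · rw [hcomult]
    exact coord_coord_translates a m n
  · rw [hcounit]
    rfl

variable (T) in
/-- The functor from monoids to Tall–Wraith monoids that lifts `freeHat`. -/
noncomputable def freeTW : MonCat.{u} ⥤ TWMon T where
  obj M := { X := (freeHat T).obj M, mon := freeHatMonObj T M }
  map {M N} f :=
    letI := (covFullyFaithful T (D := Alg T)).comonObj ((freeHat T).obj M).unop
    letI := (covFullyFaithful T (D := Alg T)).comonObj ((freeHat T).obj N).unop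
    haveI := (covFullyFaithful T (D := Alg T)).isComonHom_of_map
      ((freeHat T).map (TypeCat.ofHom f.hom)).unop
    ((Comon.ComonToMonOpOp _).map
      (Comon.Hom.mk (M := ⟨_⟩) (N := ⟨_⟩) ((freeHat T).map (TypeCat.ofHom f.hom)).unop)).unop
  map_id M := by
    ext1
    exact (freeHat T).map_id _
  map_comp f g := by
    ext1
    exact (freeHat T).map_comp (TypeCat.ofHom f.hom) (TypeCat.ofHom g.hom)

end FreeHat

end TallWraith

theorem mainTheorem2 (T : Type u) [SmallCategory T] [TallWraith.LawvereTheory T] :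
    ∃ F : MonCat.{u} ⥤ TallWraith.TWMon T,
      F ⋙ Mon.forget (TallWraith.CoAlg T) = forget MonCat.{u} ⋙ TallWraith.freeHat T ∧
      F ⋙ Mon.forget (TallWraith.CoAlg T) ⋙ TallWraith.underlying T =
        forget MonCat.{u} ⋙ TallWraith.free T ∧
      ∀ M : MonCat.{u}, ∃ X : MonObj ((TallWraith.freeHat T).obj M),
        F.obj M = { X := (TallWraith.freeHat T).obj M, mon := X } ∧
        TallWraith.IsInduced T M X :=
  ⟨TallWraith.freeTW T, rfl, rfl, fun M =>
    ⟨TallWraith.freeHatMonObj T M, rfl, TallWraith.isInduced_freeHatMonObj M⟩⟩
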